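/- Let $G$ be a finite connected graph, in which loops and parallel edges are allowed. An edge is \emph{external} if one of its ends has valency $1$ (a loop contributes $2$ to the valency of its vertex); all other edges are \emph{internal}. Let $N$ be the number of external edges and $n$ the number of internal edges, and let $x=(x_e)$ be variables indexed by the internal edges. A \emph{kinematic parameter} is a pair $z=(K,m)$, where $K=(k_{ij})$ is a real symmetric $N\times N$ matrix with zero row sums, indexed by the external edges, and $m=(m_e)$ is a real vector indexed by the internal edges. With the coordinates $k_{ij}$ for pairs $\{i,j\}$ with $i\ne j$, and $m_e$, we identify the space of kinematic parameters with $\mathbb{R}^{\binom N2+n}$. Let $\mathcal{T}$ be the set of spanning trees of $G$, and let $\mathcal{W}$ be the set of spanning $2$-forests of $G$, i.e. of subgraphs without cycles that contain all vertices and all external edges and have exactly two connected components $T_1,T_2$. Let $I_{T_1}$ and $I_{T_2}$ be the sets of external edges attached to $T_1$ and $T_2$. Put $$\mathcal{U}(x)=\sum_{T\in\mathcal{T}}\ \prod_{e\notin T}x_e,\qquad \mathcal{F}_z(x)=\sum_{\{T_1,T_2\}\in\mathcal{W}}\Bigl(\sum_{i\in I_{T_1}}\sum_{j\in I_{T_2}}k_{ij}\Bigr)\prod_{e\notin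 T_1\sqcup T_2}x_e+\Bigl(\sum_{e}m_ex_e\Bigr)\,\mathcal{U}(x).$$ The \emph{copositive cone} of $G$ is $$\mathcal{C}_G=\bigl\{z\in\mathbb{R}^{\binom N2+n}:\ \mathcal{F}_z(u)\ge 0\ \text{ for all } u\in\mathbb{R}^n_{\ge 0}\bigr\}.$$ \textbf{Proposition.} The set $\mathcal{C}_G$ is a full-dimensional closed semialgebraic convex cone in $\mathbb{R}^{\binom N2+n}$. More precisely: (a) for every $u\in\mathbb{R}^n$ the function $z\mapsto\mathcal{F}_z(u)$ is linear, so that $\mathcal{C}_G$ is the solution set of the linear inequalities $\mathcal{F}_z(u)\ge 0$, one for each $u\in\mathbb{R}^n_{\ge0}$; (b) $\mathcal{C}_G$ is closed and convex, contains $0$, and is closed under multiplication by nonnegative real numbers; (c) $\mathcal{C}_G$ contains the open orthant $\mathbb{R}^{\binom N2+n}_{>0}$ in the coordinates $k_{ij}$ $(i\neq j)$ and $m_e$, and it has nonempty interior; (d) $\mathcal{C}_G$ is semialgebraic, i.e. a finite Boolean combination of sets of the form $\{z: p(z)\ge 0\}$ with $p$ a real polynomial in $z$. -/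

import Mathlib

namespace Feynman

open MvPolynomial

noncomputable section

/-! ### Graphs

`Graph α β` is Mathlib's type of multigraphs: loops and parallel edges are allowed. -/

/-- The valency of a vertex: the number of incident edges, where a loop counts twice. -/
def valency {α β : Type*} (G : Graph α β) (v : α) : ℕ :=
  (G.incidenceSet v).ncard + (G.loopSet v).ncard

/-- An edge is external if one of its ends is a vertex of valency `1`. -/
def IsExternal {α β : Type*} (G : Graph α β) (e : β) : Prop :=
  ∃ v, valency G v = 1 ∧ G.Inc e v

/-- The type of external edges of `G`. -/
abbrev External {α β : Type*} (G : Graph α β) : Type _ :=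
  {e : β // e ∈ G.edgeSet ∧ IsExternal G e}

/-- The type of internal edges of `G`. -/
abbrev Internal {α β : Type*} (G : Graph α β) : Type _ :=
  {e : β // e ∈ G.edgeSet ∧ ¬ IsExternal G e}

/-- A multigraph is connected: it has a vertex, and any two vertices are joined by a walk. -/
def IsConnected {α β : Type*} (G : Graph α β) : Prop :=
  G.toSimpleGraph.Connected

/-- A multigraph has no cycles: it has no loops and no parallel edges (these are the cycles
of length `1` and `2`), and its underlying simple graph has no cycles. -/
def IsForest {α β : Type*} (G : Graph α β) : Prop :=
  G.Simple ∧ G.toSimpleGraph.IsAcyclic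

/-- The set `T` of edges of `G` is the edge set of a spanning tree of `G`.
Here `G.restrict T` is the subgraph with all the vertices of `G` and with edge set `T`. -/
def IsSpanningTree {α β : Type*} (G : Graph α β) (T : Finset β) : Prop :=
  (T : Set β) ⊆ G.edgeSet ∧ IsForest (G.restrict T) ∧ IsConnected (G.restrict T)

/-- The connected components of the spanning subgraph of `G` with edge set `S`. -/
abbrev Component {α β : Type*} (G : Graph α β) (S : Finset β) : Type _ :=
  (G.restrict S).toSimpleGraph.ConnectedComponent

/-- The set `S` of edges of `G` is the edge set of a spanning `2`-forest of `G`: it contains all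
external edges, it has no cycles, and it has exactly two connected components. -/
def IsSpanningTwoForest {α β : Type*} (G : Graph α β) (S : Finset β) : Prop :=
  (S : Set β) ⊆ G.edgeSet ∧ (∀ e ∈ G.edgeSet, IsExternal G e → e ∈ S) ∧
    IsForest (G.restrict S) ∧ Nat.card (Component G S) = 2

/-- The external edge `i` is attached to the connected component `T` of the spanning subgraph
with edge set `S`. -/
def IsAttached {α β : Type*} {G : Graph α β} {S : Finset β} (i : External G)
    (T : Component G S) : Prop :=
  ∃ v : (G.restrict S).vertexSet,
    (G.restrict S).toSimpleGraph.connectedComponentMk v = T ∧ (G.restrict S).Inc i.1 v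

/-! ### Kinematic parameters -/

/-- The coordinates of the kinematic space: one for each unordered pair `{i, j}` of distinct
external edges, for the parameter `k_ij`, and one for each internal edge `e`, for the
mass `m_e`. -/
abbrev KinIndex {α β : Type*} (G : Graph α β) : Type _ :=
  {p : Sym2 (External G) // ¬ p.IsDiag} ⊕ Internal G

/-- The kinematic space `ℝ^(binom(N, 2) + n)`. -/
abbrev KinSpace {α β : Type*} (G : Graph α β) : Type _ := KinIndex G → ℝ

/-- The internal masses. -/
def mass {α β : Type*} {G : Graph α β} (z : KinSpace G) (e : Internal G) : ℝ := z (Sum.inr e)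

open Classical in
/-- The off-diagonal part of the Gram matrix. -/
def offDiagGram {α β : Type*} {G : Graph α β} (z : KinSpace G) (i j : External G) : ℝ :=
  if h : i = j then 0 else z (Sum.inl ⟨s(i, j), fun hd => h (Sym2.mk_isDiag_iff.1 hd)⟩)

open Classical in
/-- The Gram matrix `K = (k_ij)`. Its off-diagonal entries are coordinates of `z`, and its diagonal
entries are such that all row sums are zero (momentum conservation). -/
def gram {α β : Type*} [Fintype β] {G : Graph α β} (z : KinSpace G) (i j : External G) : ℝ :=
  if i = j then -∑ l, offDiagGram z i l else offDiagGram z i j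

theorem offDiagGram_comm {α β : Type*} {G : Graph α β} (z : KinSpace G)
    (i j : External G) : offDiagGram z i j = offDiagGram z j i := by
  unfold offDiagGram
  by_cases h : i = j
  · subst h; rfl
  · rw [dif_neg h, dif_neg (Ne.symm h)]
    congr 2
    exact Subtype.ext Sym2.eq_swap

theorem gram_comm {α β : Type*} [Fintype β] {G : Graph α β} (z : KinSpace G)
    (i j : External G) : gram z i j = gram z j i := by
  unfold gram
  by_cases h : i = j
  · subst h; rfl
  · rw [if_neg h, if_neg (Ne.symm h), offDiagGram_comm z i j]

open Classical in
/-- The kinematic space parametrizes the pairs `(K, m)` where `K` is a symmetric matrix with zero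
row sums and `m` is an arbitrary vector of masses, each pair exactly once. -/
theorem existsUnique_kinematics {α β : Type*} [Fintype β] (G : Graph α β)
    (K : External G → External G → ℝ) (m : Internal G → ℝ) :
    ((∀ i j, K i j = K j i) ∧ ∀ i, ∑ j, K i j = 0) ↔ ∃! z : KinSpace G, gram z = K ∧ mass z = m := by
  have hoff : ∀ (z : KinSpace G) (i j : External G) (h : i ≠ j),
      gram z i j = z (Sum.inl ⟨s(i, j), fun hd => h (Sym2.mk_isDiag_iff.1 hd)⟩) := by
    intro z i j h
    simp [gram, offDiagGram, h]
  have hrow : ∀ (z : KinSpace G) (i : External G), ∑ j, gram z i j = 0 := by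
    intro z i
    have h1 : ∑ j ∈ Finset.univ.erase i, gram z i j
        = ∑ j ∈ Finset.univ.erase i, offDiagGram z i j :=
      Finset.sum_congr rfl fun j hj => if_neg (Finset.ne_of_mem_erase hj).symm
    have h2 : offDiagGram z i i = 0 := dif_pos rfl
    have h3 : gram z i i = -∑ l, offDiagGram z i l := if_pos rfl
    rw [← Finset.add_sum_erase _ _ (Finset.mem_univ i), h1, h3,
      ← Finset.add_sum_erase _ (offDiagGram z i) (Finset.mem_univ i), h2]
    ring
  constructor
  · rintro ⟨hs', hr⟩
    refine ⟨Sum.elim (fun p => Sym2.lift ⟨fun i j => K i j, hs'⟩ p.1) m, ⟨?_, ?_⟩, ?_⟩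
    · set z : KinSpace G := Sum.elim (fun p => Sym2.lift ⟨fun i j => K i j, hs'⟩ p.1) m with hz
      have hne : ∀ i j, i ≠ j → gram z i j = K i j := by
        intro i j h
        rw [hoff z i j h]
        simp [hz]
      funext i j
      by_cases h : i = j
      · subst h
        have h1 := hrow z i
        have h2 := hr i
        rw [← Finset.add_sum_erase _ _ (Finset.mem_univ i)] at h1 h2
        have h3 : ∑ x ∈ Finset.univ.erase i, gram z i x
            = ∑ x ∈ Finset.univ.erase i, K i x :=
          Finset.sum_congr rfl fun x hx => hne i x (Finset.ne_of_mem_erase hx).symm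
        linarith
      · exact hne i j h
    · rfl
    · rintro w ⟨hw, hm⟩
      funext q
      rcases q with ⟨p, hp⟩ | e
      · induction p with
        | h i j =>
          have hij : i ≠ j := fun h => hp (Sym2.mk_isDiag_iff.2 h)
          rw [← hoff w i j hij, hw]
          simp
      · rw [← hm]; rfl
  · rintro ⟨z, ⟨hz, -⟩, -⟩
    subst hz
    exact ⟨gram_comm z, hrow z⟩

/-! ### Symanzik polynomials -/

open Classical in
/-- The product of the variables `x_e` over the internal edges `e` outside `S`. -/
def complMonomial {α β : Type*} [Fintype β] (G : Graph α β) (S : Finset β) :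
    MvPolynomial (Internal G) ℝ :=
  ∏ e : Internal G with e.1 ∉ S, X e

open Classical in
/-- The first Symanzik polynomial `𝒰`. For connected `G`, the edges outside a spanning tree are all
internal. -/
def firstSymanzik {α β : Type*} [Fintype β] (G : Graph α β) :
    MvPolynomial (Internal G) ℝ :=
  ∑ T : Finset β with IsSpanningTree G T, complMonomial G T

open Classical in
/-- The sum of `k_ij` over the external edges `i` attached to `T₁` and `j` attached to `T₂`. -/
def crossSum {α β : Type*} [Fintype β] {G : Graph α β} (z : KinSpace G) {S : Finset β}
    (T₁ T₂ : Component G S) : ℝ :=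
  ∑ i : External G with IsAttached i T₁, ∑ j : External G with IsAttached j T₂, gram z i j

theorem crossSum_comm {α β : Type*} [Fintype β] {G : Graph α β} (z : KinSpace G)
    {S : Finset β} (T₁ T₂ : Component G S) : crossSum z T₁ T₂ = crossSum z T₂ T₁ := by
  unfold crossSum
  rw [Finset.sum_comm]
  exact Finset.sum_congr rfl fun j _ => Finset.sum_congr rfl fun i _ => gram_comm z i j

/-- The coefficient of a spanning `2`-forest: `crossSum z T₁ T₂` for the unordered pair `{T₁, T₂}`
of its two components. (For a spanning `2`-forest the sum has a single term.) -/
def forestCoeff {α β : Type*} [Fintype β] {G : Graph α β} (z : KinSpace G)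
    (S : Finset β) : ℝ :=
  ∑ᶠ q : {q : Sym2 (Component G S) // ¬ q.IsDiag},
    Sym2.lift ⟨fun T₁ T₂ => crossSum z T₁ T₂, crossSum_comm z⟩ q.1

open Classical in
/-- The second Symanzik polynomial `ℱ_z`. -/
def secondSymanzik {α β : Type*} [Fintype β] (G : Graph α β) (z : KinSpace G) :
    MvPolynomial (Internal G) ℝ :=
  (∑ S : Finset β with IsSpanningTwoForest G S, C (forestCoeff z S) * complMonomial G S) +
    (∑ e : Internal G, C (mass z e) * X e) * firstSymanzik G

/-! ### Copositivity and semialgebraic sets -/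

/-- A polynomial is copositive if it is nonnegative on the nonnegative orthant. -/
def IsCopositive {σ : Type*} (f : MvPolynomial σ ℝ) : Prop :=
  ∀ x : σ → ℝ, (∀ i, 0 ≤ x i) → 0 ≤ eval x f

/-- The copositive cone `𝒞_G`. -/
def copositiveCone {α β : Type*} [Fintype β] (G : Graph α β) : Set (KinSpace G) :=
  {z | IsCopositive (secondSymanzik G z)}

/-- Semialgebraic subsets of `ℝ^σ`: the finite Boolean combinations of sets that are defined by one
polynomial inequality. -/
inductive IsSemialgebraic {σ : Type*} : Set (σ → ℝ) → Prop
  | nonneg (p : MvPolynomial σ ℝ) : IsSemialgebraic {z | 0 ≤ eval z p}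
  | compl (A : Set (σ → ℝ)) : IsSemialgebraic A → IsSemialgebraic Aᶜ
  | inter (A B : Set (σ → ℝ)) : IsSemialgebraic A → IsSemialgebraic B → IsSemialgebraic (A ∩ B)

end

end Feynman

/-! Every coefficient of `secondSymanzik G z` is linear in `z`, so the copositive cone is an
intersection of closed half-spaces through the origin (`copositiveCone_eq_iInter`); closedness,
convexity and the cone property follow. For `z` in the nonnegative orthant all coefficients are
nonnegative: distinct components of a forest share no external edge (`IsAttached.unique`), so
diagonal Gram entries never enter. Hence the open positive orthant lies in the cone.

Semialgebraicity is a projection theorem: the complement of the cone is the projection of `{(z, u) |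
u ≥ 0, ℱ_z(u) < 0}`. Tarski–Seidenberg is proved here without formulas, for sets whose membership
depends only on the signs of finitely many polynomials (`IsSignDetermined`). To eliminate one
variable, a finite family of polynomials is closed under derivatives, removal of leading terms and
pseudo-remainders. If two specializations give the leading coefficients the same signs, the two
specialized families have the same sign diagram (`exists_orderMatching_of_closed`): a finite order
matching of their roots is built by increasing degree. Pseudo-remainders give the signs of a new
polynomial at the old points, and the matched signs of its derivative control it between them
(`exists_signMatches_of_derivative`). A witness for one specialization then moves to the other by
back-and-forth. -/

namespace Feynman

open Polynomial Filter Topology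

/-! ### Sign diagrams of real polynomials -/

/-- The points `x` and `y` lie in the same position relative to the first, respectively the second
components of the pairs in `S`. -/
def SamePos (S : Finset (ℝ × ℝ)) (x y : ℝ) : Prop :=
  ∀ p ∈ S, (p.1 < x ↔ p.2 < y) ∧ (x < p.1 ↔ y < p.2)

/-- The pairs in `S` form a finite partial order isomorphism of `ℝ`. -/
def IsOrderMatching (S : Finset (ℝ × ℝ)) : Prop :=
  ∀ q ∈ S, SamePos S q.1 q.2

/-- The polynomials `f` and `g` have the same signs at points in the same position. -/
def SignMatches (S : Finset (ℝ × ℝ)) (f g : ℝ[X]) : Prop :=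
  ∀ x y, SamePos S x y → SignType.sign (f.eval x) = SignType.sign (g.eval y)

/-- Each cell on the left is paired with at most one cell on the right, so the relation is a union
of rectangles. -/
theorem SamePos.trans {S : Finset (ℝ × ℝ)} {x y c d : ℝ} (hxy : SamePos S x y)
    (hc : SamePos S c y) (hd : SamePos S x d) : SamePos S c d := fun p hp =>
  ⟨(hc p hp).1.trans ((hxy p hp).1.symm.trans (hd p hp).1),
    (hc p hp).2.trans ((hxy p hp).2.symm.trans (hd p hp).2)⟩

theorem SamePos.mono {S S' : Finset (ℝ × ℝ)} (h : S ⊆ S') {x y : ℝ} (hxy : SamePos S' x y) :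
    SamePos S x y := fun p hp => hxy p (h hp)

theorem SamePos.eq_iff {S : Finset (ℝ × ℝ)} {x y : ℝ} (hxy : SamePos S x y) {p : ℝ × ℝ}
    (hp : p ∈ S) : p.1 = x ↔ p.2 = y := by
  have := hxy p hp
  constructor <;> intro h
  · exact le_antisymm (not_lt.1 fun h' => (this.2.2 h').ne' h)
      (not_lt.1 fun h' => (this.1.2 h').ne h)
  · exact le_antisymm (not_lt.1 fun h' => (this.2.1 h').ne' h)
      (not_lt.1 fun h' => (this.1.1 h').ne h)

theorem samePos_neg {S : Finset (ℝ × ℝ)} {x y : ℝ} :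
    SamePos (S.image fun p => (-p.1, -p.2)) x y ↔ SamePos S (-x) (-y) := by
  simp only [SamePos, Finset.forall_mem_image]
  refine forall₂_congr fun p _ => ?_
  rw [neg_lt, neg_lt (a := p.2), lt_neg, lt_neg (b := p.2)]
  exact and_comm

theorem samePos_swap {S : Finset (ℝ × ℝ)} {x y : ℝ} :
    SamePos (S.image Prod.swap) x y ↔ SamePos S y x := by
  simp only [SamePos, Finset.forall_mem_image]
  refine forall₂_congr fun p _ => ?_
  simp only [Prod.fst_swap, Prod.snd_swap]
  tauto

theorem SignMatches.swap {S : Finset (ℝ × ℝ)} {f g : ℝ[X]} (h : SignMatches S f g) :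
    SignMatches (S.image Prod.swap) g f := fun x y hxy => (h y x (samePos_swap.1 hxy)).symm

theorem SignMatches.neg {S : Finset (ℝ × ℝ)} {f g : ℝ[X]} (h : SignMatches S f g) :
    SignMatches S (-f) (-g) := fun x y hxy => by
  rw [eval_neg, eval_neg, Left.sign_neg, Left.sign_neg, h x y hxy]

/-- The back-and-forth property. -/
theorem IsOrderMatching.exists_samePos {S : Finset (ℝ × ℝ)} (hS : IsOrderMatching S) (x : ℝ) :
    ∃ y, SamePos S x y := by
  -- Mathlib states partial isomorphisms of linear orders through `cmp`; back-and-forth then holds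
  -- because `ℝ` is dense without endpoints.
  have key : ∀ {a b c d : ℝ}, ((a < b ↔ c < d) ∧ (b < a ↔ d < c)) ↔ cmp a b = cmp c d := by
    intro a b c d
    constructor
    · rintro ⟨h1, h2⟩
      rcases lt_trichotomy a b with h | h | h
      · rw [cmp_eq_lt_iff _ _ |>.2 h, cmp_eq_lt_iff _ _ |>.2 (h1.1 h)]
      · have : c = d := le_antisymm (not_lt.1 fun h' => (h2.2 h').ne' h)
          (not_lt.1 fun h' => (h1.2 h').ne h)
        rw [h, this, cmp_self_eq_eq, cmp_self_eq_eq]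
      · rw [cmp_eq_gt_iff _ _ |>.2 h, cmp_eq_gt_iff _ _ |>.2 (h2.1 h)]
    · intro h
      exact ⟨lt_iff_lt_of_cmp_eq_cmp h, lt_iff_lt_of_cmp_eq_cmp (cmp_eq_cmp_symm.1 h)⟩
  obtain ⟨y, hy⟩ := Order.PartialIso.exists_across (α := ℝ) (β := ℝ)
    ⟨S, fun p hp q hq => key.1 (hS q hq p hp)⟩ x
  exact ⟨y, fun p hp => key.2 (hy p hp)⟩

/-- Away from the points of `S` all comparisons are strict, hence stable under small perturbation.
-/
theorem SamePos.eventually {S : Finset (ℝ × ℝ)} {x y : ℝ} (hxy : SamePos S x y)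
    (hx : ∀ p ∈ S, p.1 ≠ x) : ∀ᶠ t in 𝓝 x, SamePos S t y := by
  simp only [SamePos, ← Finset.mem_coe]
  refine (eventually_all_finite S.finite_toSet).2 fun p hp => ?_
  have h := hxy p hp
  rcases lt_or_gt_of_ne (hx p hp) with hlt | hlt
  · filter_upwards [lt_mem_nhds hlt] with t ht
    exact ⟨iff_of_true ht (h.1.1 hlt), iff_of_false ht.not_gt (h.1.1 hlt).not_gt⟩
  · filter_upwards [gt_mem_nhds hlt] with t ht
    exact ⟨iff_of_false ht.not_gt (h.2.1 hlt).not_gt, iff_of_true ht (h.2.1 hlt)⟩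

theorem SamePos.ordConnected {S : Finset (ℝ × ℝ)} {y : ℝ} :
    {t | SamePos S t y}.OrdConnected := by
  refine ⟨fun a ha b hb t ht p hp => ⟨⟨fun h => ?_, fun h => ?_⟩, ⟨fun h => ?_, fun h => ?_⟩⟩⟩
  · exact (hb p hp).1.1 (h.trans_le ht.2)
  · exact ((ha p hp).1.2 h).trans_le ht.1
  · exact (ha p hp).2.1 (ht.1.trans_lt h)
  · exact ht.2.trans_lt ((hb p hp).2.2 h)

theorem SamePos.ordConnected' {S : Finset (ℝ × ℝ)} {x : ℝ} :
    {t | SamePos S x t}.OrdConnected := by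
  have := SamePos.ordConnected (S := S.image Prod.swap) (y := x)
  simpa only [samePos_swap] using this

/-- A nonzero polynomial whose signs are matched does not vanish in the interior of a cell. -/
theorem SignMatches.eval_ne_zero {S : Finset (ℝ × ℝ)} {f g : ℝ[X]} (h : SignMatches S f g)
    (hf : f ≠ 0) {x y : ℝ} (hxy : SamePos S x y) (hx : ∀ p ∈ S, p.1 ≠ x) : f.eval x ≠ 0 := by
  intro h0
  -- The sign of `g` at the fixed `y` governs `f` on the whole cell, so a single zero would produce
  -- a neighbourhood of zeros.
  refine hf (f.eq_zero_of_infinite_isRoot (Set.Infinite.mono ?_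
    (infinite_of_mem_nhds x (hxy.eventually hx))))
  intro t ht
  have h1 := h t y ht
  rw [← h x y hxy, h0, sign_zero, sign_eq_zero_iff] at h1
  exact h1

theorem SignMatches.pos_or_neg {S : Finset (ℝ × ℝ)} {f g : ℝ[X]} (h : SignMatches S f g)
    (hf : f ≠ 0) {x y : ℝ} (hxy : SamePos S x y) (hx : ∀ p ∈ S, p.1 ≠ x) :
    ((∀ t, SamePos S t y → 0 < f.eval t) ∧ ∀ t, SamePos S x t → 0 < g.eval t) ∨
      ((∀ t, SamePos S t y → f.eval t < 0) ∧ ∀ t, SamePos S x t → g.eval t < 0) := by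
  rcases lt_or_gt_of_ne (h.eval_ne_zero hf hxy hx) with h0 | h0
  · refine Or.inr ⟨fun t ht => ?_, fun t ht => ?_⟩
    · rw [← sign_eq_neg_one_iff, h t y ht, ← h x y hxy, sign_eq_neg_one_iff]; exact h0
    · rw [← sign_eq_neg_one_iff, ← h x t ht, sign_eq_neg_one_iff]; exact h0
  · refine Or.inl ⟨fun t ht => ?_, fun t ht => ?_⟩
    · rw [← sign_eq_one_iff, h t y ht, ← h x y hxy, sign_eq_one_iff]; exact h0
    · rw [← sign_eq_one_iff, ← h x t ht, sign_eq_one_iff]; exact h0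

/-! ### Transfer of signs from the derivative to the polynomial -/

theorem strictMonoOn_eval_of_pos {D : Set ℝ} (hD : D.OrdConnected) {f : ℝ[X]}
    (h : ∀ t ∈ interior D, 0 < f.derivative.eval t) : StrictMonoOn (fun t => f.eval t) D :=
  strictMonoOn_of_deriv_pos hD.convex f.continuous.continuousOn fun t ht => by
    simpa using h t ht

theorem strictAntiOn_eval_of_neg {D : Set ℝ} (hD : D.OrdConnected) {f : ℝ[X]}
    (h : ∀ t ∈ interior D, f.derivative.eval t < 0) : StrictAntiOn (fun t => f.eval t) D :=
  strictAntiOn_of_deriv_neg hD.convex f.continuous.continuousOn fun t ht => by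
    simpa using h t ht

/-- Since `f` increases on the cell, it is positive at the right end of the cell. There the signs of
`f` and `g` agree, and continuity makes `g` positive just inside. If the cell is unbounded to the
right, the increasing nonconstant `g` is eventually positive. -/
theorem exists_eval_pos_of_derivative_pos {S : Finset (ℝ × ℝ)} (hSm : IsOrderMatching S)
    {f g : ℝ[X]} (hg : 0 < g.degree) {x y : ℝ} (hxy : SamePos S x y) (hxS : ∀ p ∈ S, p.1 ≠ x)
    (hS : ∀ p ∈ S, SignType.sign (f.eval p.1) = SignType.sign (g.eval p.2))
    (hf' : ∀ t, SamePos S t y → 0 < f.derivative.eval t)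
    (hg' : ∀ t, SamePos S x t → 0 < g.derivative.eval t) (hx : 0 < f.eval x) :
    ∃ t, SamePos S x t ∧ 0 < g.eval t := by
  by_cases hR : (S.filter fun p => x < p.1).Nonempty
  · obtain ⟨p, hp, hmin⟩ := Finset.exists_min_image _ Prod.fst hR
    obtain ⟨hpS, hxp⟩ := Finset.mem_filter.1 hp
    have hyp : y < p.2 := (hxy p hpS).2.1 hxp
    have hfp : 0 < f.eval p.1 := by
      have hmono : StrictMonoOn (fun t => f.eval t) (Set.Icc x p.1) := by
        refine strictMonoOn_eval_of_pos Set.ordConnected_Icc fun t ht => hf' t fun q hq => ?_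
        rw [interior_Icc] at ht
        rcases lt_or_gt_of_ne (hxS q hq) with h | h
        · have h' := (hxy q hq).1.1 h
          exact ⟨iff_of_true (h.trans ht.1) h', iff_of_false (h.trans ht.1).not_gt h'.not_gt⟩
        · have h' := (hxy q hq).2.1 h
          have h2 := ht.2.trans_le (hmin q (Finset.mem_filter.2 ⟨hq, h⟩))
          exact ⟨iff_of_false h2.not_gt h'.not_gt, iff_of_true h2 h'⟩
      exact hx.trans (hmono (Set.left_mem_Icc.2 hxp.le) (Set.right_mem_Icc.2 hxp.le) hxp)
    have hgp : 0 < g.eval p.2 := by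
      rw [← sign_eq_one_iff, ← hS p hpS, sign_eq_one_iff]; exact hfp
    have hev : ∀ᶠ t in 𝓝[<] p.2, 0 < g.eval t ∧ y < t ∧ t < p.2 := by
      refine ((g.continuous.continuousAt.eventually (lt_mem_nhds hgp)).filter_mono
        nhdsWithin_le_nhds).and ?_
      exact Ioo_mem_nhdsLT hyp
    obtain ⟨t, ht0, hyt, htp⟩ := hev.exists
    refine ⟨t, fun q hq => ?_, ht0⟩
    rcases lt_or_gt_of_ne (hxS q hq) with h | h
    · have h' := ((hxy q hq).1.1 h).trans hyt
      exact ⟨iff_of_true h h', iff_of_false h.not_gt h'.not_gt⟩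
    · have h1 := hmin q (Finset.mem_filter.2 ⟨hq, h⟩)
      have h2 : t < q.2 := htp.trans_le (not_lt.1 fun h3 => h1.not_gt ((hSm p hpS q hq).1.2 h3))
      exact ⟨iff_of_false h.not_gt h2.not_gt, iff_of_true h h2⟩
  · rw [Finset.not_nonempty_iff_eq_empty, Finset.filter_eq_empty_iff] at hR
    have hpos : ∀ t, y ≤ t → SamePos S x t := fun t ht q hq => by
      have h := lt_of_le_of_ne (not_lt.1 (hR hq)) (hxS q hq)
      have h' := ((hxy q hq).1.1 h).trans_le ht
      exact ⟨iff_of_true h h', iff_of_false h.not_gt h'.not_gt⟩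
    have hmono : StrictMonoOn (fun t => g.eval t) (Set.Ici y) :=
      strictMonoOn_eval_of_pos Set.ordConnected_Ici fun t ht => hg' t (hpos t (interior_subset ht))
    -- The sign of the leading coefficient is not known, so only `|g|` is seen to be unbounded;
    -- monotonicity excludes `-∞`.
    obtain ⟨t, ht, hyt⟩ := (((g.abs_tendsto_atTop hg).eventually_gt_atTop |g.eval y|).and
      (eventually_gt_atTop y)).exists
    refine ⟨t, hpos t hyt.le, ?_⟩
    have h1 : g.eval y < g.eval t := hmono Set.self_mem_Ici hyt.le hyt
    by_contra h2
    rw [abs_of_nonpos (not_lt.1 h2), abs_of_nonpos (h1.le.trans (not_lt.1 h2))] at ht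
    linarith

theorem IsOrderMatching.neg {S : Finset (ℝ × ℝ)} (h : IsOrderMatching S) :
    IsOrderMatching (S.image fun p => (-p.1, -p.2)) := by
  simp only [IsOrderMatching, samePos_neg, Finset.forall_mem_image, neg_neg]
  exact h

theorem IsOrderMatching.swap {S : Finset (ℝ × ℝ)} (h : IsOrderMatching S) :
    IsOrderMatching (S.image Prod.swap) := by
  simp only [IsOrderMatching, samePos_swap, Finset.forall_mem_image, Prod.fst_swap, Prod.snd_swap]
  exact h

/-- The sign of `f` at the end of a cell, and hence the existence of a point of the cell where `f`
is positive, carries over to `g`. -/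
theorem exists_eval_pos {S : Finset (ℝ × ℝ)} (hSm : IsOrderMatching S)
    {f g : ℝ[X]} (hf : 0 < f.degree) (hg : 0 < g.degree)
    (hd : SignMatches S f.derivative g.derivative)
    (hS : ∀ p ∈ S, SignType.sign (f.eval p.1) = SignType.sign (g.eval p.2))
    {x y : ℝ} (hxy : SamePos S x y) (hxS : ∀ p ∈ S, p.1 ≠ x) (hx : 0 < f.eval x) :
    ∃ t, SamePos S x t ∧ 0 < g.eval t := by
  have hf0 : f.derivative ≠ 0 := fun h =>
    (natDegree_pos_iff_degree_pos.2 hf).ne' (derivative_eq_zero.1 h)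
  rcases hd.pos_or_neg hf0 hxy hxS with ⟨h1, h2⟩ | ⟨h1, h2⟩
  · exact exists_eval_pos_of_derivative_pos hSm hg hxy hxS hS h1 h2 hx
  -- The decreasing case is the increasing one after the reflection `t ↦ -t`.
  · have hdeg : (g.comp (-X)).degree = g.degree := by simp
    obtain ⟨t, ht, ht0⟩ := exists_eval_pos_of_derivative_pos (f := f.comp (-X)) (g := g.comp (-X))
      (x := -x) (y := -y) hSm.neg (hdeg.symm ▸ hg) (samePos_neg.2 (by simpa using hxy))
      (Finset.forall_mem_image.2 fun p hp => by simpa using hxS p hp)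
      (Finset.forall_mem_image.2 fun p hp => by simpa using hS p hp)
      (fun t ht => by simpa [derivative_comp] using h1 (-t) (by simpa using samePos_neg.1 ht))
      (fun t ht => by simpa [derivative_comp] using h2 (-t) (by simpa using samePos_neg.1 ht))
      (by simpa using hx)
    exact ⟨-t, by simpa using samePos_neg.1 ht, by simpa using ht0⟩

theorem exists_eval_eq_zero {D : Set ℝ} (hD : D.OrdConnected) (f : ℝ[X]) {a b : ℝ} (ha : a ∈ D)
    (hb : b ∈ D) (hfa : f.eval a ≤ 0) (hfb : 0 ≤ f.eval b) : ∃ c ∈ D, f.eval c = 0 :=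
  hD.isPreconnected.intermediate_value ha hb f.continuous.continuousOn ⟨hfa, hfb⟩

/-- If `f x ≤ 0`, then both `f` and `g` take both signs on their cells, so they have roots `c` and
`d` there. Both are strictly monotone in the same direction, so `g y > 0` and `f x ≤ 0` place `y`
and `x` differently relative to `d` and `c`, against `hroots`. -/
theorem eval_pos_of_samePos {S : Finset (ℝ × ℝ)} (hSm : IsOrderMatching S)
    {f g : ℝ[X]} (hf : 0 < f.degree) (hg : 0 < g.degree)
    (hd : SignMatches S f.derivative g.derivative)
    (hS : ∀ p ∈ S, SignType.sign (f.eval p.1) = SignType.sign (g.eval p.2))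
    {x y : ℝ} (hxy : SamePos S x y) (hxS : ∀ p ∈ S, p.1 ≠ x)
    (hroots : ∀ c d, f.eval c = 0 → g.eval d = 0 → SamePos S c d →
      (c < x ↔ d < y) ∧ (x < c ↔ y < d)) (hy : 0 < g.eval y) : 0 < f.eval x := by
  by_contra hx
  rw [not_lt] at hx
  have hf0 : f.derivative ≠ 0 := fun h =>
    (natDegree_pos_iff_degree_pos.2 hf).ne' (derivative_eq_zero.1 h)
  have hyS : ∀ p ∈ S, p.2 ≠ y := fun p hp h => hxS p hp ((hxy.eq_iff hp).2 h)
  have hS' : ∀ p ∈ S.image Prod.swap,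
      SignType.sign (g.eval p.1) = SignType.sign (f.eval p.2) :=
    Finset.forall_mem_image.2 fun p hp => (hS p hp).symm
  obtain ⟨a, ha, ha0⟩ : ∃ a, SamePos S a y ∧ 0 < f.eval a := by
    have := exists_eval_pos hSm.swap hg hf hd.swap hS' (samePos_swap.2 hxy)
      (Finset.forall_mem_image.2 hyS) hy
    simpa only [samePos_swap] using this
  obtain ⟨c, hc, hc0⟩ := exists_eval_eq_zero SamePos.ordConnected f hxy ha hx ha0.le
  -- a point of the cell of `x` where `f` is negative
  obtain ⟨x', hx', hx0⟩ : ∃ x', SamePos S x' y ∧ f.eval x' < 0 := by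
    rcases hx.lt_or_eq with h | h
    · exact ⟨x, hxy, h⟩
    -- At a root `x` inside an open cell, strict monotonicity makes `f` negative on one side.
    · obtain ⟨l, r, ⟨hl, hr⟩, hlr⟩ := mem_nhds_iff_exists_Ioo_subset.1 (hxy.eventually hxS)
      obtain ⟨m, hlm, hmx⟩ := exists_between hl
      obtain ⟨m', hxm, hmr⟩ := exists_between hr
      have hm : SamePos S m y := hlr ⟨hlm, hmx.trans hr⟩
      have hm' : SamePos S m' y := hlr ⟨hl.trans hxm, hmr⟩
      rcases hd.pos_or_neg hf0 hxy hxS with ⟨h1, -⟩ | ⟨h1, -⟩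
      · exact ⟨m, hm, h ▸ strictMonoOn_eval_of_pos SamePos.ordConnected
          (fun t ht => h1 t (interior_subset ht)) hm hxy hmx⟩
      · exact ⟨m', hm', h ▸ strictAntiOn_eval_of_neg SamePos.ordConnected
          (fun t ht => h1 t (interior_subset ht)) hxy hm' hxm⟩
  obtain ⟨b, hb, hb0⟩ : ∃ b, SamePos S x b ∧ g.eval b < 0 := by
    obtain ⟨t, ht, ht0⟩ := exists_eval_pos (f := -f) (g := -g) hSm (by simpa) (by simpa)
      (by simpa using hd.neg) (by simpa [Left.sign_neg] using hS) hx'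
      (fun p hp h => hyS p hp ((hx'.eq_iff hp).1 h)) (by simpa using hx0)
    exact ⟨t, hx'.trans hxy ht, by simpa using ht0⟩
  obtain ⟨d, hd', hd0⟩ := exists_eval_eq_zero SamePos.ordConnected' g hb hxy hb0.le hy.le
  have hcd := hroots c d hc0 hd0 (hxy.trans hc hd')
  rcases hd.pos_or_neg hf0 hxy hxS with ⟨h1, h2⟩ | ⟨h1, h2⟩
  · have hfm := strictMonoOn_eval_of_pos SamePos.ordConnected fun t ht => h1 t (interior_subset ht)
    have hgm := strictMonoOn_eval_of_pos SamePos.ordConnected' fun t ht => h2 t (interior_subset ht)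
    have h3 : d < y := (hgm.lt_iff_lt hd' hxy).1 (by simpa [hd0] using hy)
    have h4 : x ≤ c := (hfm.le_iff_le hxy hc).1 (by simpa [hc0] using hx)
    exact h4.not_gt (hcd.1.2 h3)
  · have hfm := strictAntiOn_eval_of_neg SamePos.ordConnected fun t ht => h1 t (interior_subset ht)
    have hgm := strictAntiOn_eval_of_neg SamePos.ordConnected' fun t ht => h2 t (interior_subset ht)
    have h3 : y < d := (hgm.lt_iff_gt hd' hxy).1 (by simpa [hd0] using hy)
    have h4 : c ≤ x := (hfm.le_iff_ge hxy hc).1 (by simpa [hc0] using hx)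
    exact h4.not_gt (hcd.2.2 h3)

theorem sign_eval_eq_of_samePos {S : Finset (ℝ × ℝ)} (hSm : IsOrderMatching S)
    {f g : ℝ[X]} (hf : 0 < f.degree) (hg : 0 < g.degree)
    (hd : SignMatches S f.derivative g.derivative)
    (hS : ∀ p ∈ S, SignType.sign (f.eval p.1) = SignType.sign (g.eval p.2))
    {x y : ℝ} (hxy : SamePos S x y) (hxS : ∀ p ∈ S, p.1 ≠ x)
    (hroots : ∀ c d, f.eval c = 0 → g.eval d = 0 → SamePos S c d →
      (c < x ↔ d < y) ∧ (x < c ↔ y < d)) :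
    SignType.sign (f.eval x) = SignType.sign (g.eval y) := by
  have hyS : ∀ p ∈ S, p.2 ≠ y := fun p hp h => hxS p hp ((hxy.eq_iff hp).2 h)
  -- the same statement for all four combinations of swapping and negating
  have main : ∀ {f g : ℝ[X]}, 0 < f.degree → 0 < g.degree →
      SignMatches S f.derivative g.derivative →
      (∀ p ∈ S, SignType.sign (f.eval p.1) = SignType.sign (g.eval p.2)) →
      (∀ c d, f.eval c = 0 → g.eval d = 0 → SamePos S c d →
        (c < x ↔ d < y) ∧ (x < c ↔ y < d)) → (0 < f.eval x ↔ 0 < g.eval y) := by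
    intro f g hf hg hd hS hroots
    refine ⟨fun h => ?_, eval_pos_of_samePos hSm hf hg hd hS hxy hxS hroots⟩
    refine eval_pos_of_samePos hSm.swap hg hf hd.swap
      (Finset.forall_mem_image.2 fun p hp => (hS p hp).symm) (samePos_swap.2 hxy)
      (Finset.forall_mem_image.2 hyS) (fun c d hc hd' hcd => ?_) h
    have := hroots d c hd' hc (samePos_swap.1 hcd)
    exact ⟨this.1.symm, this.2.symm⟩
  have hpos := main hf hg hd hS hroots
  have hneg := main (f := -f) (g := -g) (by simpa) (by simpa) (by simpa using hd.neg)
    (by simpa [Left.sign_neg] using hS) (by simpa using hroots)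
  simp only [eval_neg, Left.neg_pos_iff] at hneg
  rcases lt_trichotomy (f.eval x) 0 with h | h | h
  · rw [sign_neg h, sign_neg (hneg.1 h)]
  · have : g.eval y = 0 := le_antisymm (not_lt.1 fun h' => (hpos.2 h').ne' h)
      (not_lt.1 fun h' => (hneg.2 h').ne h)
    rw [h, this]
  · rw [sign_pos h, sign_pos (hpos.1 h)]

/-- By Rolle, two roots of `f` with no point of `S` between them would give a zero of `f'` inside a
cell. So a point of `S` separates them, possibly coinciding with one, and orders `d₁` and `d₂`. -/
theorem snd_lt_snd_of_roots {S : Finset (ℝ × ℝ)} {f : ℝ[X]} {g' : ℝ[X]} (hf : 0 < f.degree)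
    (hd : SignMatches S f.derivative g') {c₁ c₂ d₁ d₂ : ℝ} (h₁ : SamePos S c₁ d₁)
    (h₂ : SamePos S c₂ d₂) (hc₁ : f.eval c₁ = 0) (hc₂ : f.eval c₂ = 0) (hlt : c₁ < c₂) :
    d₁ < d₂ := by
  have hf0 : f.derivative ≠ 0 := fun h =>
    (natDegree_pos_iff_degree_pos.2 hf).ne' (derivative_eq_zero.1 h)
  by_cases h : ∃ p ∈ S, c₁ ≤ p.1 ∧ p.1 ≤ c₂
  · obtain ⟨p, hp, h1, h2⟩ := h
    have h3 : d₁ ≤ p.2 := not_lt.1 fun h => h1.not_gt ((h₁ p hp).1.2 h)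
    have h4 : p.2 ≤ d₂ := not_lt.1 fun h => h2.not_gt ((h₂ p hp).2.2 h)
    refine lt_of_le_of_ne (h3.trans h4) fun h5 => hlt.ne ?_
    rw [← (h₁.eq_iff hp).2 (le_antisymm (h5 ▸ h4) h3),
      ← (h₂.eq_iff hp).2 (le_antisymm h4 (h5 ▸ h3))]
  · push Not at h
    obtain ⟨ξ, hξ, hξ0⟩ := exists_hasDerivAt_eq_zero hlt f.continuous.continuousOn
      (hc₁.trans hc₂.symm) fun t _ => f.hasDerivAt t
    refine absurd hξ0 (hd.eval_ne_zero hf0 (y := d₁) (fun p hp => ?_) fun p hp h' => ?_)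
    · rcases lt_or_ge p.1 c₁ with h1 | h1
      · have h2 := (h₁ p hp).1.1 h1
        exact ⟨iff_of_true (h1.trans hξ.1) h2, iff_of_false (h1.trans hξ.1).not_gt h2.not_gt⟩
      · have h3 := h p hp h1
        have h2 := (h₁ p hp).2.1 (hlt.trans h3)
        exact ⟨iff_of_false (hξ.2.trans h3).not_gt h2.not_gt, iff_of_true (hξ.2.trans h3) h2⟩
    · exact (h p hp (h' ▸ hξ.1.le)).not_gt (h' ▸ hξ.2)

/-- An order matching for which the signs of `f'` and `g'` agree, and whose points do not separate
the signs of `f` and `g`, extends by the roots of `f` and `g` to an order matching for which the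
signs of `f` and `g` agree. -/
theorem exists_signMatches_of_derivative {S : Finset (ℝ × ℝ)} (hSm : IsOrderMatching S)
    {f g : ℝ[X]} (hf : 0 < f.degree) (hg : 0 < g.degree)
    (hd : SignMatches S f.derivative g.derivative)
    (hS : ∀ p ∈ S, SignType.sign (f.eval p.1) = SignType.sign (g.eval p.2)) :
    ∃ S', S ⊆ S' ∧ IsOrderMatching S' ∧ SignMatches S' f g ∧
      ∀ p ∈ S', p ∈ S ∨ f.eval p.1 = 0 := by
  classical
  have hf0 : f ≠ 0 := ne_zero_of_degree_gt hf
  have hg0 : g ≠ 0 := ne_zero_of_degree_gt hg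
  -- Roots in corresponding cells are paired. No count is needed: an open cell holds at most one
  -- root of each polynomial.
  let N := (f.roots.toFinset ×ˢ g.roots.toFinset).filter fun p => SamePos S p.1 p.2
  have hN : ∀ p, p ∈ N ↔ (f.eval p.1 = 0 ∧ g.eval p.2 = 0) ∧ SamePos S p.1 p.2 := by
    simp [N, hf0, hg0]
  refine ⟨S ∪ N, Finset.subset_union_left, fun q hq p hp => ?_, fun x y hxy => ?_, fun p hp => ?_⟩
  · rcases Finset.mem_union.1 hp with hp | hp <;> rcases Finset.mem_union.1 hq with hq | hq
    · exact hSm q hq p hp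
    · exact ((hN q).1 hq).2 p hp
    · exact (((hN p).1 hp).2 q hq).symm
    · obtain ⟨⟨hp1, hp2⟩, hp3⟩ := (hN p).1 hp
      obtain ⟨⟨hq1, hq2⟩, hq3⟩ := (hN q).1 hq
      exact ⟨⟨snd_lt_snd_of_roots hf hd hp3 hq3 hp1 hq1,
          snd_lt_snd_of_roots hg hd.swap (samePos_swap.2 hp3) (samePos_swap.2 hq3) hp2 hq2⟩,
        ⟨snd_lt_snd_of_roots hf hd hq3 hp3 hq1 hp1,
          snd_lt_snd_of_roots hg hd.swap (samePos_swap.2 hq3) (samePos_swap.2 hp3) hq2 hp2⟩⟩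
  · have hxy' : SamePos S x y := hxy.mono Finset.subset_union_left
    by_cases h : ∀ p ∈ S, p.1 ≠ x
    · exact sign_eval_eq_of_samePos hSm hf hg hd hS hxy' h fun c d hc hd' hcd =>
        hxy (c, d) (Finset.mem_union_right _ ((hN _).2 ⟨⟨hc, hd'⟩, hcd⟩))
    · push Not at h
      obtain ⟨p, hp, rfl⟩ := h
      rw [← (hxy'.eq_iff hp).1 rfl]
      exact hS p hp
  · rcases Finset.mem_union.1 hp with hp | hp
    · exact Or.inl hp
    · exact Or.inr ((hN p).1 hp).1.1

end Feynman

namespace Feynman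

open Polynomial

/-! ### Elimination of one variable -/

/-- Leading terms are cancelled repeatedly; the power of the leading coefficient replaces division,
which is unavailable in `A`. -/
theorem exists_pseudoDivision {A : Type*} [CommRing A] (g : A[X]) (hg : 0 < g.natDegree)
    (f : A[X]) : ∃ (k : ℕ) (q r : A[X]), C (g.leadingCoeff ^ k) * f = q * g + r ∧
      r.natDegree < g.natDegree := by
  induction h : f.natDegree using Nat.strong_induction_on generalizing f with
  | _ n ih =>
    by_cases hfg : f.natDegree < g.natDegree
    · exact ⟨0, 0, f, by simp, hfg⟩
    · rw [not_lt] at hfg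
      have hlt : (C g.leadingCoeff * f -
          C f.leadingCoeff * X ^ (f.natDegree - g.natDegree) * g).natDegree < n := by
        have := natDegree_cancelLeads_lt_of_natDegree_le_natDegree hfg (hg.trans_le hfg)
        rw [cancelLeads, Nat.sub_eq_zero_of_le hfg, pow_zero, mul_one] at this
        exact this.trans_eq h
      obtain ⟨k, q, r, h1, h2⟩ := ih _ hlt _ rfl
      refine ⟨k + 1, q + C (g.leadingCoeff ^ k) * (C f.leadingCoeff *
        X ^ (f.natDegree - g.natDegree)), r, ?_, h2⟩
      rw [pow_succ, C_mul]
      linear_combination h1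

/-- If all `op f g` have smaller degree than `g`, then every finite set is contained in a finite set
that is closed under `op` (applied to elements of ordered, positive degree). -/
theorem exists_finset_closed {B : Type*} [DecidableEq B] (deg : B → ℕ) (op : B → B → Finset B)
    (hop : ∀ f g, 0 < deg g → ∀ r ∈ op f g, deg r < deg g) (F : Finset B) :
    ∃ F', F ⊆ F' ∧ ∀ f ∈ F', ∀ g ∈ F', 0 < deg g → deg g ≤ deg f → op f g ⊆ F' := by
  -- Closure is demanded only for `g` of degree above `n`, which is vacuous at the maximal degree.
  -- Handling degree `n + 1` adds only elements of degree at most `n`, so what is settled stays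
  -- settled.
  suffices H : ∀ n, ∀ F : Finset B,
      (∀ f ∈ F, ∀ g ∈ F, n < deg g → deg g ≤ deg f → op f g ⊆ F) →
      ∃ F', F ⊆ F' ∧ ∀ f ∈ F', ∀ g ∈ F', 0 < deg g → deg g ≤ deg f → op f g ⊆ F' by
    refine H (F.sup deg) F fun f _ g hg h => ?_
    exact absurd (Finset.le_sup (f := deg) hg) h.not_ge
  intro n
  induction n with
  | zero => exact fun F hF => ⟨F, subset_rfl, hF⟩
  | succ n ih =>
    intro F hF
    let F₁ := F ∪ ((F ×ˢ F).filter fun p => deg p.2 = n + 1).biUnion fun p => op p.1 p.2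
    have hmem : ∀ f ∈ F₁, n < deg f → f ∈ F := fun f hf hn => by
      rcases Finset.mem_union.1 hf with h | h
      · exact h
      · obtain ⟨p, hp, hfp⟩ := Finset.mem_biUnion.1 h
        have hp2 := (Finset.mem_filter.1 hp).2
        have := hop p.1 p.2 (by omega) f hfp
        omega
    obtain ⟨F', h1, h2⟩ := ih F₁ fun f hf g hg hn hle => by
      have hfF := hmem f hf (hn.trans_le hle)
      have hgF := hmem g hg hn
      rcases (Nat.succ_le_of_lt hn).lt_or_eq with h | h
      · exact (hF f hfF g hgF h hle).trans Finset.subset_union_left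
      · exact fun r hr => Finset.mem_union_right _ (Finset.mem_biUnion.2
          ⟨(f, g), Finset.mem_filter.2 ⟨Finset.mk_mem_product hfF hgF, h.symm⟩, hr⟩)
    exact ⟨F', Finset.subset_union_left.trans h1, h2⟩

theorem natDegree_eraseLead_lt' {A : Type*} [CommRing A] {f : A[X]} (hf : 0 < f.natDegree) :
    f.eraseLead.natDegree < f.natDegree := by
  have := f.eraseLead_natDegree_le
  omega

theorem map_eraseLead_of_leadingCoeff_eq_zero {A : Type*} [CommRing A] {f : A[X]} (z : A →+* ℝ)
    (h : z f.leadingCoeff = 0) : f.eraseLead.map z = f.map z := by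
  have := congrArg (Polynomial.map z) f.eraseLead_add_C_mul_X_pow
  simpa only [Polynomial.map_add, Polynomial.map_mul, map_C, h, C_0, zero_mul, add_zero] using this

/-- For a finite family of polynomials with the right closure properties, the signs of the leading
coefficients determine the sign diagram. -/
theorem exists_orderMatching_of_closed {A : Type*} [CommRing A] {F : Finset A[X]}
    {R : A[X] → A[X] → A[X]}
    (hR : ∀ f g, 0 < g.natDegree → (R f g).natDegree < g.natDegree ∧
      ∃ (k : ℕ) (q : A[X]), C (g.leadingCoeff ^ k) * f = q * g + R f g)
    (hF : ∀ f ∈ F, ∀ g ∈ F, 0 < g.natDegree → g.natDegree ≤ f.natDegree →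
      derivative g ∈ F ∧ g.eraseLead ∈ F ∧ R f g ∈ F)
    {z w : A →+* ℝ}
    (hzw : ∀ f ∈ F, SignType.sign (z f.leadingCoeff) = SignType.sign (w f.leadingCoeff)) :
    ∃ S, IsOrderMatching S ∧ ∀ f ∈ F, SignMatches S (f.map z) (f.map w) := by
  classical
  -- Induction over subfamilies closed downward in degree. The last clause, that each point is a
  -- root of a nonzero specialized member, lets remainders determine the sign of the next polynomial
  -- there.
  suffices H : ∀ E : Finset A[X], E ⊆ F →
      (∀ f ∈ E, ∀ g ∈ F, g.natDegree < f.natDegree → g ∈ E) →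
      ∃ S, IsOrderMatching S ∧ (∀ f ∈ E, SignMatches S (f.map z) (f.map w)) ∧
        ∀ p ∈ S, ∃ f ∈ E, f.map z ≠ 0 ∧ (f.map z).eval p.1 = 0 by
    obtain ⟨S, h1, h2, -⟩ := H F subset_rfl fun _ _ g hg _ => hg
    exact ⟨S, h1, h2⟩
  intro E
  induction E using Finset.induction_on_max_value (natDegree (R := A)) with
  | empty => exact fun _ _ => ⟨∅, by simp [IsOrderMatching], by simp, by simp⟩
  | insert f E hfE hmax ih =>
    intro hEF hlow
    have hfF : f ∈ F := hEF (Finset.mem_insert_self _ _)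
    have hEF' : E ⊆ F := (Finset.subset_insert _ _).trans hEF
    have hE : ∀ g ∈ F, g.natDegree < f.natDegree → g ∈ E := fun g hg hlt =>
      (Finset.mem_insert.1 (hlow f (Finset.mem_insert_self _ _) g hg hlt)).resolve_left
        fun h => hlt.ne (h ▸ rfl)
    obtain ⟨S, hS, hSE, hroot⟩ := ih hEF' fun g hg h hh hlt =>
      hE h hh (hlt.trans_le (hmax g hg))
    -- no new points are needed if the signs of `f` are already matched
    have extend : SignMatches S (f.map z) (f.map w) → ∃ S, IsOrderMatching S ∧
        (∀ g ∈ insert f E, SignMatches S (g.map z) (g.map w)) ∧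
        ∀ p ∈ S, ∃ g ∈ insert f E, g.map z ≠ 0 ∧ (g.map z).eval p.1 = 0 := fun h =>
      ⟨S, hS, (Finset.forall_mem_insert f E _).2 ⟨h, hSE⟩, fun p hp => by
        obtain ⟨g, hg, hg'⟩ := hroot p hp
        exact ⟨g, Finset.mem_insert_of_mem hg, hg'⟩⟩
    rcases f.natDegree.eq_zero_or_pos with h0 | hpos
    · refine extend fun x y _ => ?_
      have := hzw f hfF
      rw [leadingCoeff, h0] at this
      rw [eq_C_of_natDegree_eq_zero h0]
      simpa using this
    obtain ⟨hder, hera, -⟩ := hF f hfF f hfF hpos le_rfl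
    -- If the leading coefficient dies under both maps, `f` may be replaced by `f.eraseLead`,
    -- already in `E`.
    by_cases hz : z f.leadingCoeff = 0
    · have hw : w f.leadingCoeff = 0 := by
        have := hzw f hfF
        rw [hz, sign_zero, eq_comm, sign_eq_zero_iff] at this
        exact this
      refine extend ?_
      rw [← map_eraseLead_of_leadingCoeff_eq_zero z hz,
        ← map_eraseLead_of_leadingCoeff_eq_zero w hw]
      exact hSE _ (hE _ hera (natDegree_eraseLead_lt' hpos))
    have hw : w f.leadingCoeff ≠ 0 := by
      intro hw
      have := hzw f hfF
      rw [hw, sign_zero, sign_eq_zero_iff] at this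
      exact hz this
    have hdeg : ∀ v : A →+* ℝ, v f.leadingCoeff ≠ 0 → 0 < (f.map v).degree := fun v hv => by
      rw [← natDegree_pos_iff_degree_pos, natDegree_map_of_leadingCoeff_ne_zero v hv]
      exact hpos
    have hsign : ∀ p ∈ S, SignType.sign ((f.map z).eval p.1) =
        SignType.sign ((f.map w).eval p.2) := by
      intro p hp
      -- Minimal degree forces the leading coefficient of `g` to survive under `z`; otherwise
      -- `g.eraseLead` would have the same specialization. At the root, the pseudo-remainder is then
      -- a nonzero multiple of `f`.
      obtain ⟨g, hg, hmin⟩ := Finset.exists_min_image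
        (E.filter fun g => g.map z ≠ 0 ∧ (g.map z).eval p.1 = 0) natDegree
        (by obtain ⟨g, hg, hg'⟩ := hroot p hp; exact ⟨g, Finset.mem_filter.2 ⟨hg, hg'⟩⟩)
      obtain ⟨hgE, hgz, hgp⟩ := Finset.mem_filter.1 hg
      have hgpos : 0 < g.natDegree := by
        by_contra h
        rw [eq_C_of_natDegree_eq_zero (Nat.eq_zero_of_not_pos h)] at hgz hgp
        simp only [map_C, eval_C] at hgz hgp
        exact hgz (by rw [hgp, C_0])
      obtain ⟨-, hgera, hrem⟩ := hF f hfF g (hEF' hgE) hgpos (hmax g hgE)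
      have hlc : z g.leadingCoeff ≠ 0 := fun h => by
        have h1 := map_eraseLead_of_leadingCoeff_eq_zero z h
        have h2 := natDegree_eraseLead_lt' hgpos
        refine h2.not_ge (hmin _ (Finset.mem_filter.2
          ⟨hE _ hgera (h2.trans_le (hmax g hgE)), ?_⟩))
        rw [h1]
        exact ⟨hgz, hgp⟩
      have hgw : (g.map w).eval p.2 = 0 := by
        have := hSE g hgE p.1 p.2 (hS p hp)
        rw [hgp, sign_zero, eq_comm, sign_eq_zero_iff] at this
        exact this
      obtain ⟨hRdeg, k, q, hq⟩ := hR f g hgpos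
      have hRs := hSE _ (hE _ hrem (hRdeg.trans_le (hmax g hgE))) p.1 p.2 (hS p hp)
      have hev : ∀ (v : A →+* ℝ) (t : ℝ), (g.map v).eval t = 0 →
          ((R f g).map v).eval t = v g.leadingCoeff ^ k * (f.map v).eval t := by
        intro v t ht
        have := congrArg (fun h => (h.map v).eval t) hq
        simpa [ht] using this.symm
      rw [hev z _ hgp, hev w _ hgw, sign_mul, sign_mul, sign_pow, sign_pow,
        hzw g (hEF' hgE)] at hRs
      refine mul_left_cancel₀ (pow_ne_zero k ?_) hRs
      rw [← hzw g (hEF' hgE)]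
      exact fun h => hlc (sign_eq_zero_iff.1 h)
    obtain ⟨S', hSS', hS', hfS', hroot'⟩ := exists_signMatches_of_derivative hS (hdeg z hz)
      (hdeg w hw) (by
        rw [derivative_map, derivative_map]
        exact hSE _ (hE _ hder (natDegree_derivative_lt hpos.ne'))) hsign
    refine ⟨S', hS', (Finset.forall_mem_insert f E _).2
      ⟨hfS', fun g hg x y hxy => hSE g hg x y (hxy.mono hSS')⟩, fun p hp => ?_⟩
    rcases hroot' p hp with h | h
    · obtain ⟨g, hg, hg'⟩ := hroot p h
      exact ⟨g, Finset.mem_insert_of_mem hg, hg'⟩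
    · exact ⟨f, Finset.mem_insert_self _ _, ne_zero_of_degree_gt (hdeg z hz), h⟩

/-- For every finite family of polynomials with coefficients in `A` there are finitely many elements
of `A` whose signs determine the sign diagram of the family. -/
theorem exists_finset_orderMatching {A : Type*} [CommRing A] (F : Finset A[X]) :
    ∃ H : Finset A, ∀ z w : A →+* ℝ,
      (∀ h ∈ H, SignType.sign (z h) = SignType.sign (w h)) →
      ∃ S, IsOrderMatching S ∧ ∀ f ∈ F, SignMatches S (f.map z) (f.map w) := by
  classical
  have hex : ∀ f g : A[X], ∃ r : A[X], 0 < g.natDegree → r.natDegree < g.natDegree ∧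
      ∃ (k : ℕ) (q : A[X]), C (g.leadingCoeff ^ k) * f = q * g + r := fun f g => by
    by_cases hg : 0 < g.natDegree
    · obtain ⟨k, q, r, h1, h2⟩ := exists_pseudoDivision g hg f
      exact ⟨r, fun _ => ⟨h2, k, q, h1⟩⟩
    · exact ⟨0, fun h => absurd h hg⟩
  choose R hR using hex
  obtain ⟨F', hFF', hF'⟩ := exists_finset_closed natDegree
    (fun f g : A[X] => {derivative g, g.eraseLead, R f g}) (fun f g hg r hr => by
      simp only [Finset.mem_insert, Finset.mem_singleton] at hr
      rcases hr with rfl | rfl | rfl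
      · exact natDegree_derivative_lt hg.ne'
      · exact natDegree_eraseLead_lt' hg
      · exact (hR f g hg).1) F
  refine ⟨F'.image leadingCoeff, fun z w hzw => ?_⟩
  obtain ⟨S, h1, h2⟩ := exists_orderMatching_of_closed hR (fun f hf g hg hpos hle => by
    simpa [Finset.insert_subset_iff] using hF' f hf g hg hpos hle)
    (fun f hf => hzw _ (Finset.mem_image_of_mem _ hf))
  exact ⟨S, h1, fun f hf => h2 f (hFF' hf)⟩

/-! ### Projections of semialgebraic sets -/

/-- Membership in `B` only depends on the signs of finitely many polynomials. -/
def IsSignDetermined {σ : Type*} (B : Set (σ → ℝ)) : Prop :=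
  ∃ P : Finset (MvPolynomial σ ℝ), ∀ a b : σ → ℝ,
    (∀ p ∈ P, SignType.sign (MvPolynomial.eval a p) = SignType.sign (MvPolynomial.eval b p)) →
    a ∈ B → b ∈ B

theorem IsSignDetermined.compl {σ : Type*} {B : Set (σ → ℝ)} (h : IsSignDetermined B) :
    IsSignDetermined Bᶜ := by
  obtain ⟨P, hP⟩ := h
  exact ⟨P, fun a b hab ha hb => ha (hP b a (fun p hp => (hab p hp).symm) hb)⟩

theorem IsSemialgebraic.univ {σ : Type*} : IsSemialgebraic (Set.univ : Set (σ → ℝ)) := by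
  simpa using IsSemialgebraic.nonneg (0 : MvPolynomial σ ℝ)

theorem IsSemialgebraic.union {σ : Type*} {A B : Set (σ → ℝ)} (hA : IsSemialgebraic A)
    (hB : IsSemialgebraic B) : IsSemialgebraic (A ∪ B) := by
  rw [← compl_compl (A ∪ B), Set.compl_union]
  exact .compl _ (.inter _ _ (.compl _ hA) (.compl _ hB))

theorem isSemialgebraic_sign_eq {σ : Type*} (p : MvPolynomial σ ℝ) (s : SignType) :
    IsSemialgebraic {z | SignType.sign (MvPolynomial.eval z p) = s} := by
  have hle : IsSemialgebraic {z | MvPolynomial.eval z p ≤ 0} := by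
    simpa using IsSemialgebraic.nonneg (-p)
  have hge : IsSemialgebraic {z | 0 ≤ MvPolynomial.eval z p} := .nonneg p
  rcases s.trichotomy with rfl | rfl | rfl
  · simpa [sign_eq_neg_one_iff, Set.compl_ofPred] using hge.compl
  · convert IsSemialgebraic.inter _ _ hle hge using 1
    ext z
    exact sign_eq_zero_iff.trans le_antisymm_iff
  · simpa [sign_eq_one_iff, Set.compl_ofPred] using hle.compl

theorem IsSignDetermined.isSemialgebraic {σ : Type*} {B : Set (σ → ℝ)} (h : IsSignDetermined B) :
    IsSemialgebraic B := by
  classical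
  obtain ⟨P, hP⟩ := h
  induction P using Finset.induction_on generalizing B with
  | empty =>
    rcases B.eq_empty_or_nonempty with rfl | ⟨a, ha⟩
    · simpa using (IsSemialgebraic.univ (σ := σ)).compl
    · rw [Set.eq_univ_of_forall fun b => hP a b (by simp) ha]
      exact .univ
  | insert p P _ ih =>
    -- Once the sign `s` of `p` is fixed, the remaining condition depends on the signs of `P` alone,
    -- so induction applies to each of three pieces.
    have hB : ∀ s : SignType, IsSemialgebraic
        ({z | SignType.sign (MvPolynomial.eval z p) = s} ∩
          {b | ∃ a ∈ B, SignType.sign (MvPolynomial.eval a p) = s ∧ ∀ q ∈ P,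
            SignType.sign (MvPolynomial.eval a q) = SignType.sign (MvPolynomial.eval b q)}) :=
      fun s => .inter _ _ (isSemialgebraic_sign_eq p s) (ih fun b c hbc ⟨a, ha, h1, h2⟩ =>
        ⟨a, ha, h1, fun q hq => (h2 q hq).trans (hbc q hq)⟩)
    convert ((hB 0).union (hB 1)).union (hB (-1)) using 1
    ext b
    constructor
    · intro hb
      rcases (SignType.sign (MvPolynomial.eval b p)).trichotomy with h | h | h
      · exact Or.inr ⟨h, b, hb, h, fun _ _ => rfl⟩
      · exact Or.inl (Or.inl ⟨h, b, hb, h, fun _ _ => rfl⟩)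
      · exact Or.inl (Or.inr ⟨h, b, hb, h, fun _ _ => rfl⟩)
    · rintro ((⟨h, a, ha, h1, h2⟩ | ⟨h, a, ha, h1, h2⟩) | ⟨h, a, ha, h1, h2⟩) <;>
      exact hP a b (Finset.forall_mem_insert _ _ _ |>.2 ⟨h1.trans (Eq.symm h), h2⟩) ha

/-- The image of a set under projection along one coordinate (as a cylinder). -/
theorem IsSignDetermined.exists_update {σ : Type*} [DecidableEq σ] {B : Set (σ → ℝ)}
    (h : IsSignDetermined B) (i : σ) :
    IsSignDetermined {z | ∃ t, Function.update z i t ∈ B} := by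
  classical
  obtain ⟨P, hP⟩ := h
  -- The coordinate `i` becomes the polynomial variable; the others move into the coefficient ring.
  let φ : MvPolynomial σ ℝ →ₐ[ℝ] (MvPolynomial σ ℝ)[X] :=
    MvPolynomial.aeval fun j => if j = i then X else C (MvPolynomial.X j)
  have hφ : ∀ (z : σ → ℝ) (t : ℝ) (p : MvPolynomial σ ℝ),
      ((φ p).map (MvPolynomial.eval z)).eval t = MvPolynomial.eval (Function.update z i t) p := by
    intro z t p
    have : (((Polynomial.evalRingHom t).comp (Polynomial.mapRingHom (MvPolynomial.eval z))).comp
        φ.toRingHom) = MvPolynomial.eval (Function.update z i t) := by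
      refine MvPolynomial.ringHom_ext (fun r => ?_) fun j => ?_
      · simp [φ, MvPolynomial.algebraMap_eq, Polynomial.algebraMap_apply]
      · by_cases hj : j = i
        · subst hj; simp [φ]
        · simp [φ, hj]
    exact congrArg (fun ψ : MvPolynomial σ ℝ →+* ℝ => ψ p) this
  obtain ⟨H, hH⟩ := exists_finset_orderMatching (P.image φ)
  refine ⟨H, fun z w hzw ⟨t, ht⟩ => ?_⟩
  obtain ⟨S, hS, hSP⟩ := hH _ _ hzw
  -- The witness `t` over `z` is carried to the same position `u` over `w`.
  obtain ⟨u, hu⟩ := hS.exists_samePos t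
  refine ⟨u, hP _ _ (fun p hp => ?_) ht⟩
  rw [← hφ, ← hφ]
  exact hSP _ (Finset.mem_image_of_mem _ hp) t u hu

/-- Projections are kept as cylinders in the same space, so coordinates can be eliminated one at a
time. -/
theorem IsSignDetermined.exists_piecewise {σ : Type*} {B : Set (σ → ℝ)}
    (h : IsSignDetermined B) (s : Finset σ) :
    IsSignDetermined {z | ∃ u ∈ B, ∀ i ∉ s, u i = z i} := by
  classical
  induction s using Finset.induction_on with
  | empty =>
    convert h using 1
    ext z
    exact ⟨fun ⟨u, hu, huz⟩ => (funext fun i => huz i (by simp)) ▸ hu, fun hz => ⟨z, hz, by simp⟩⟩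
  | insert i s _ ih =>
    convert ih.exists_update i using 1
    ext z
    constructor
    · rintro ⟨u, hu, huz⟩
      refine ⟨u i, u, hu, fun j hj => ?_⟩
      by_cases hji : j = i
      · subst hji; simp
      · rw [Function.update_of_ne hji]
        exact huz j (by simp [hji, hj])
    · rintro ⟨t, u, hu, huz⟩
      refine ⟨u, hu, fun j hj => ?_⟩
      rw [Finset.mem_insert, not_or] at hj
      rw [huz j hj.2, Function.update_of_ne hj.1]

/-- The image of `B` under projection along finitely many coordinates. -/
theorem IsSignDetermined.exists_elim {σ τ : Type*} [Fintype τ] {B : Set (σ ⊕ τ → ℝ)}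
    (h : IsSignDetermined B) : IsSignDetermined {z : σ → ℝ | ∃ u : τ → ℝ, Sum.elim z u ∈ B} := by
  classical
  obtain ⟨P, hP⟩ := h.exists_piecewise (Finset.univ.map ⟨Sum.inr, Sum.inr_injective⟩)
  -- The cylinder is insensitive to the eliminated coordinates, so they can be set to `0`.
  let ρ : MvPolynomial (σ ⊕ τ) ℝ →ₐ[ℝ] MvPolynomial σ ℝ :=
    MvPolynomial.aeval (Sum.elim MvPolynomial.X 0)
  have hρ : ∀ (z : σ → ℝ) (p : MvPolynomial (σ ⊕ τ) ℝ),
      MvPolynomial.eval z (ρ p) = MvPolynomial.eval (Sum.elim z 0) p := by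
    intro z p
    have : (MvPolynomial.eval z).comp ρ.toRingHom =
        MvPolynomial.eval (Sum.elim z (0 : τ → ℝ)) := by
      refine MvPolynomial.ringHom_ext (fun r => ?_) fun j => ?_
      · simp [ρ, MvPolynomial.algebraMap_eq]
      · rcases j with j | j <;> simp [ρ]
    exact congrArg (fun ψ : MvPolynomial (σ ⊕ τ) ℝ →+* ℝ => ψ p) this
  refine ⟨P.image ρ, fun a b hab ⟨u, hu⟩ => ?_⟩
  obtain ⟨v, hv, hvb⟩ := hP (Sum.elim a 0) (Sum.elim b 0) (fun p hp => by
    rw [← hρ, ← hρ]; exact hab _ (Finset.mem_image_of_mem _ hp)) ⟨_, hu, by simp⟩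
  refine ⟨v ∘ Sum.inr, ?_⟩
  convert hv using 1
  ext (i | i)
  · simpa using (hvb (Sum.inl i) (by simp)).symm
  · rfl

end Feynman

namespace Feynman

open MvPolynomial

/-! ### The second Symanzik polynomial as a function of the kinematics -/

section Linearity

variable {α β : Type*} {G : Graph α β}

theorem offDiagGram_add (z w : KinSpace G) (i j : External G) :
    offDiagGram (z + w) i j = offDiagGram z i j + offDiagGram w i j := by
  unfold offDiagGram
  split_ifs <;> simp

theorem offDiagGram_smul (c : ℝ) (z : KinSpace G) (i j : External G) :
    offDiagGram (c • z) i j = c * offDiagGram z i j := by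
  unfold offDiagGram
  split_ifs <;> simp

theorem offDiagGram_nonneg {z : KinSpace G} (hz : ∀ i, 0 ≤ z i) (i j : External G) :
    0 ≤ offDiagGram z i j := by
  unfold offDiagGram
  split_ifs
  · exact le_rfl
  · exact hz _

/-- An external edge is attached to at most one component. -/
theorem IsAttached.unique {S : Finset β} {i : External G} {T₁ T₂ : Component G S}
    (h₁ : IsAttached i T₁) (h₂ : IsAttached i T₂) : T₁ = T₂ := by
  obtain ⟨v₁, rfl, hv₁⟩ := h₁
  obtain ⟨v₂, rfl, hv₂⟩ := h₂
  by_cases h : v₁ = v₂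
  · rw [h]
  · obtain ⟨y, hy⟩ := hv₁
    have hy2 : v₂.1 = y := hv₂.eq_of_isLink_of_ne_left hy fun h' => h (Subtype.ext h'.symm)
    refine SimpleGraph.ConnectedComponent.connectedComponentMk_eq_of_adj ?_
    rw [Graph.toSimpleGraph_adj]
    exact ⟨h, i.1, hy2 ▸ hy⟩

variable [Fintype β]

theorem gram_add (z w : KinSpace G) (i j : External G) :
    gram (z + w) i j = gram z i j + gram w i j := by
  unfold gram
  split_ifs
  · simp only [offDiagGram_add, Finset.sum_add_distrib, neg_add]
  · exact offDiagGram_add z w i j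

theorem gram_smul (c : ℝ) (z : KinSpace G) (i j : External G) :
    gram (c • z) i j = c * gram z i j := by
  unfold gram
  split_ifs
  · simp only [offDiagGram_smul, ← Finset.mul_sum, mul_neg]
  · exact offDiagGram_smul c z i j

theorem crossSum_add (z w : KinSpace G) {S : Finset β} (T₁ T₂ : Component G S) :
    crossSum (z + w) T₁ T₂ = crossSum z T₁ T₂ + crossSum w T₁ T₂ := by
  simp only [crossSum, gram_add, Finset.sum_add_distrib]

theorem crossSum_smul (c : ℝ) (z : KinSpace G) {S : Finset β} (T₁ T₂ : Component G S) :
    crossSum (c • z) T₁ T₂ = c * crossSum z T₁ T₂ := by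
  simp only [crossSum, gram_smul, Finset.mul_sum]

/-- Only off-diagonal Gram entries occur, because an external edge is attached to at most one
component. -/
theorem crossSum_nonneg {z : KinSpace G} (hz : ∀ i, 0 ≤ z i) {S : Finset β}
    {T₁ T₂ : Component G S} (h : T₁ ≠ T₂) : 0 ≤ crossSum z T₁ T₂ := by
  classical
  refine Finset.sum_nonneg fun i hi => Finset.sum_nonneg fun j hj => ?_
  have hij : i ≠ j := fun hij => h
    (IsAttached.unique (Finset.mem_filter.1 hi).2 (hij ▸ (Finset.mem_filter.1 hj).2))
  rw [gram, if_neg hij]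
  exact offDiagGram_nonneg hz i j

theorem forestCoeff_nonneg {z : KinSpace G} (hz : ∀ i, 0 ≤ z i) (S : Finset β) :
    0 ≤ forestCoeff z S := by
  refine finsum_nonneg fun ⟨q, hq⟩ => ?_
  induction q with
  | h T₁ T₂ => exact crossSum_nonneg hz fun h => hq (Sym2.mk_isDiag_iff.2 h)

theorem eval_complMonomial_nonneg {u : Internal G → ℝ} (hu : ∀ e, 0 ≤ u e) (S : Finset β) :
    0 ≤ eval u (complMonomial G S) := by
  rw [complMonomial, map_prod]
  exact Finset.prod_nonneg fun e _ => by simpa using hu e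

theorem eval_firstSymanzik_nonneg {u : Internal G → ℝ} (hu : ∀ e, 0 ≤ u e) :
    0 ≤ eval u (firstSymanzik G) := by
  rw [firstSymanzik, map_sum]
  exact Finset.sum_nonneg fun T _ => eval_complMonomial_nonneg hu T

theorem eval_secondSymanzik_nonneg {z : KinSpace G} (hz : ∀ i, 0 ≤ z i)
    {u : Internal G → ℝ} (hu : ∀ e, 0 ≤ u e) : 0 ≤ eval u (secondSymanzik G z) := by
  simp only [secondSymanzik, map_add, map_mul, map_sum, eval_C, eval_X]
  refine add_nonneg (Finset.sum_nonneg fun S _ => mul_nonneg (forestCoeff_nonneg hz S)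
    (eval_complMonomial_nonneg hu S)) (mul_nonneg (Finset.sum_nonneg fun e _ =>
      mul_nonneg (hz _) (hu e)) (eval_firstSymanzik_nonneg hu))

variable [Finite α]

theorem forestCoeff_add (z w : KinSpace G) (S : Finset β) :
    forestCoeff (z + w) S = forestCoeff z S + forestCoeff w S := by
  -- Additivity of `finsum` requires finite supports, guaranteed by the finite vertex set.
  have : Finite (Component G S) := Quot.finite _
  rw [forestCoeff, forestCoeff, forestCoeff,
    ← finsum_add_distrib (Set.toFinite _) (Set.toFinite _)]
  refine finsum_congr fun ⟨q, hq⟩ => ?_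
  induction q with
  | h T₁ T₂ => exact crossSum_add z w T₁ T₂

theorem forestCoeff_smul (c : ℝ) (z : KinSpace G) (S : Finset β) :
    forestCoeff (c • z) S = c * forestCoeff z S := by
  have : Finite (Component G S) := Quot.finite _
  rw [forestCoeff, forestCoeff, ← smul_eq_mul, smul_finsum]
  refine finsum_congr fun ⟨q, hq⟩ => ?_
  induction q with
  | h T₁ T₂ => exact crossSum_smul c z T₁ T₂

variable (G) in
/-- The value of the second Symanzik polynomial at `u` as a linear form in the kinematics. -/
noncomputable def secondSymanzikEval (u : Internal G → ℝ) : KinSpace G →ₗ[ℝ] ℝ where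
  toFun z := eval u (secondSymanzik G z)
  map_add' z w := by
    simp only [secondSymanzik, map_add, map_mul, map_sum, eval_C, eval_X, forestCoeff_add, mass,
      Pi.add_apply, add_mul, Finset.sum_add_distrib]
    ring
  map_smul' c z := by
    simp only [secondSymanzik, map_add, map_mul, map_sum, eval_C, eval_X, forestCoeff_smul, mass,
      Pi.smul_apply, smul_eq_mul, RingHom.id_apply, mul_assoc, ← Finset.mul_sum, mul_add]

/-! ### Half-space description and semialgebraicity of the cone -/

theorem copositiveCone_eq_iInter : copositiveCone G =
    ⋂ u ∈ {u : Internal G → ℝ | ∀ e, 0 ≤ u e}, {z | 0 ≤ secondSymanzikEval G u z} := by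
  ext z
  simp only [Set.mem_iInter]
  rfl

variable (G) in
/-- The second Symanzik polynomial as a polynomial in the kinematics and the edge variables. -/
theorem exists_universal_secondSymanzik : ∃ Φ : MvPolynomial (KinIndex G ⊕ Internal G) ℝ,
    ∀ z u, eval (Sum.elim z u) Φ = eval u (secondSymanzik G z) := by
  classical
  let _ := Fintype.ofFinite (KinIndex G)
  -- By linearity in `z`, the polynomial is the combination of its values at the standard basis
  -- vectors.
  refine ⟨∑ k, X (Sum.inl k) * rename Sum.inr (secondSymanzik G (Pi.single k 1)), fun z u => ?_⟩
  change _ = secondSymanzikEval G u z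
  rw [LinearMap.pi_apply_eq_sum_univ, map_sum]
  refine Finset.sum_congr rfl fun k _ => ?_
  rw [map_mul, eval_X, eval_rename, Sum.elim_comp_inr, Sum.elim_inl, smul_eq_mul]
  have hk : (Pi.single k 1 : KinSpace G) = fun j => if k = j then 1 else 0 := by
    ext j
    simp [Pi.single_apply, eq_comm]
  rw [hk]
  rfl

/-- The complement is obtained by eliminating `u` from `u ≥ 0` and `ℱ_z(u) < 0`, conditions on the
signs of `Φ` and the edge variables. -/
theorem isSemialgebraic_copositiveCone : IsSemialgebraic (copositiveCone G) := by
  classical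
  obtain ⟨Φ, hΦ⟩ := exists_universal_secondSymanzik G
  have hB : IsSignDetermined {v : KinIndex G ⊕ Internal G → ℝ |
      (∀ e, 0 ≤ v (Sum.inr e)) ∧ eval v Φ < 0} := by
    refine ⟨insert Φ (Finset.univ.image fun e => X (Sum.inr e)), fun a b hab ⟨h1, h2⟩ => ?_⟩
    rw [Finset.forall_mem_insert, Finset.forall_mem_image] at hab
    refine ⟨fun e => ?_, ?_⟩
    · have := hab.2 (Finset.mem_univ e)
      rw [eval_X, eval_X] at this
      rw [← sign_nonneg_iff, ← this, sign_nonneg_iff]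
      exact h1 e
    · rw [← sign_eq_neg_one_iff, ← hab.1, sign_eq_neg_one_iff]
      exact h2
  convert hB.exists_elim.compl.isSemialgebraic using 1
  ext z
  simp only [Set.mem_compl_iff, Set.mem_ofPred_eq, not_exists, not_and, not_lt, hΦ]
  rfl

end Linearity

end Feynman

/-! ### Assembly of the proposition -/

theorem mainTheorem7 {α β : Type*} [Fintype α] [Fintype β] (G : Graph α β)
    (hG : Feynman.IsConnected G) :
    -- the ambient space has dimension `binom(N, 2) + n`
    Module.finrank ℝ (Feynman.KinSpace G) =
        (Nat.card (Feynman.External G)).choose 2 + Nat.card (Feynman.Internal G) ∧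
    -- the cone is cut out by the linear inequalities `ℱ_z(u) ≥ 0`, one for each `u ≥ 0`
    (∃ L : (Feynman.Internal G → ℝ) → (Feynman.KinSpace G →ₗ[ℝ] ℝ),
      (∀ u z, L u z = MvPolynomial.eval u (Feynman.secondSymanzik G z)) ∧
      Feynman.copositiveCone G = ⋂ u ∈ {u : Feynman.Internal G → ℝ | ∀ e, 0 ≤ u e},
        {z | 0 ≤ L u z}) ∧
    -- it is a closed convex cone
    IsClosed (Feynman.copositiveCone G) ∧
    Convex ℝ (Feynman.copositiveCone G) ∧
    (0 : Feynman.KinSpace G) ∈ Feynman.copositiveCone G ∧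
    (∀ c : ℝ, 0 ≤ c → ∀ z ∈ Feynman.copositiveCone G, c • z ∈ Feynman.copositiveCone G) ∧
    -- it contains the positive orthant, and it is full-dimensional
    {z : Feynman.KinSpace G | ∀ i, 0 < z i} ⊆ Feynman.copositiveCone G ∧
    (interior (Feynman.copositiveCone G)).Nonempty ∧
    -- it is semialgebraic
    Feynman.IsSemialgebraic (Feynman.copositiveCone G) := by
  classical
  have horthant : {z : Feynman.KinSpace G | ∀ i, 0 < z i} ⊆ Feynman.copositiveCone G :=
    fun z hz u hu => Feynman.eval_secondSymanzik_nonneg (fun i => (hz i).le) hu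
  refine ⟨?_, ⟨Feynman.secondSymanzikEval G, fun _ _ => rfl, Feynman.copositiveCone_eq_iInter⟩,
    ?_, ?_, ?_, ?_, horthant, ?_, Feynman.isSemialgebraic_copositiveCone⟩
  · let _ := Fintype.ofFinite (Feynman.KinIndex G)
    rw [Module.finrank_fintype_fun_eq_card, ← Nat.card_eq_fintype_card, Nat.card_sum,
      Sym2.natCard_subtype_not_diag]
  · rw [Feynman.copositiveCone_eq_iInter]
    exact isClosed_biInter fun u _ => isClosed_le continuous_const
      (LinearMap.continuous_of_finiteDimensional _)
  · rw [Feynman.copositiveCone_eq_iInter]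
    exact convex_iInter₂ fun u _ => convex_halfSpace_ge (LinearMap.isLinear _) 0
  · intro u _
    exact (map_zero (Feynman.secondSymanzikEval G u)).ge
  · intro c hc z hz u hu
    have h := map_smul (Feynman.secondSymanzikEval G u) c z
    exact h.symm ▸ mul_nonneg hc (hz u hu)
  -- The positive orthant is open, since there are finitely many coordinates, and contains the
  -- all-ones point.
  · refine ⟨fun _ => 1, interior_mono horthant ?_⟩
    rw [IsOpen.interior_eq]
    · exact fun _ => one_pos
    · simp only [Set.ofPred_forall]
      exact isOpen_iInter_of_finite fun i => isOpen_lt continuous_const (continuous_apply i)
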